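/- Let $k\ge 1$ and let $p=(p_1,\dots,p_k)$ satisfy $p_j>0$ for all $j$ and $\sum_{j=1}^k p_j=1$. Let $X_1,X_2,\dots$ be independent random vectors in $\mathbb{R}^k$, each with the multinomial$(1,p)$ distribution, that is, $P(X_i=e_j)=p_j$ for $1\le j\le k$, where $e_1,\dots,e_k$ is the standard basis of $\mathbb{R}^k$. For $n\ge 1$ let $N_j=N_j^{(n)}=\sum_{i=1}^n X_{ij}$ be the number of successes in category $j$ in the first $n$ trials, and let $$\chi^2_n=\sum_{j=1}^k \frac{(N_j-np_j)^2}{np_j}$$ be the Pearson chi-square statistic. Then, as $n\to\infty$, $\chi^2_n$ converges in distribution to the chi-square distribution with $k-1$ degrees of freedom, that is, to the law of the sum of the squares of $k-1$ independent standard normal random variables (the point mass at $0$ if $k=1$). -/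

import Mathlib

open MeasureTheory ProbabilityTheory Filter

/-- The multinomial distribution with one trial and cell probabilities `p`, as a measure on `ℝ^k`:
it gives mass `p j` to the `j`-th standard basis vector (a single one, in the component of the
category of success, and zeros elsewhere). -/
noncomputable def multinomialOne {k : ℕ} (p : Fin k → ℝ) : Measure (Fin k → ℝ) :=
  ∑ j : Fin k, ENNReal.ofReal (p j) • Measure.dirac (Pi.single j (1 : ℝ))

/-- The chi-square distribution with `d` degrees of freedom: the law of the sum of the squares of
`d` independent standard normal random variables (the point mass at `0` if `d = 0`). -/
noncomputable def chiSquare (d : ℕ) : Measure ℝ :=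
  (Measure.pi fun _ : Fin d => gaussianReal 0 1).map fun z => ∑ i, z i ^ 2

/-- The number of successes in category `j` in the first `n` trials; the trials are numbered
from `0`. -/
noncomputable def categoryCount {Ω : Type*} {k : ℕ} (X : ℕ → Ω → Fin k → ℝ) (n : ℕ) (j : Fin k)
    (ω : Ω) : ℝ :=
  ∑ i ∈ Finset.range n, X i ω j

/-- The Pearson chi-square statistic of the first `n` trials. -/
noncomputable def pearsonStatistic {Ω : Type*} {k : ℕ} (p : Fin k → ℝ) (X : ℕ → Ω → Fin k → ℝ)
    (n : ℕ) (ω : Ω) : ℝ :=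
  ∑ j, (categoryCount X n j ω - n * p j) ^ 2 / (n * p j)

/-!
Write `q = (√p₁, …, √p_k)`, a unit vector because `∑ j, p j = 1`, and standardize each trial to
`Zᵢ = ((X i j - p j) / √(p j))_j` in Euclidean space. The Pearson statistic is then exactly
`‖n^(-1/2) (Z₁ + ⋯ + Zₙ)‖²` (`pearsonStatistic_eq_norm_sq`). The `Zᵢ` are independent, centered,
and the variance of `⟪Zᵢ, t⟫` is `‖t - ⟪q, t⟫ q‖²`, the squared norm of the orthogonal projection
of `t` to `qᗮ` (`integral_inner_standardize_sq`): the covariance matrix `1 - q qᵀ` is the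
orthogonal projection to `qᗮ`, of rank `k - 1`.

By the central limit theorem in a Euclidean space (`tendstoInDistribution_inv_sqrt_smul_sum`), the
normalized sums converge in distribution to the standard Gaussian vector of the hyperplane `qᗮ`
(`charFun_map_subtype_stdGaussian`). Its coordinates in an orthonormal basis of `qᗮ` are `k - 1`
independent standard normal variables, so its squared norm is chi-square distributed with `k - 1`
degrees of freedom (`map_norm_sq_stdGaussian`), and the continuous mapping theorem concludes.
-/

open scoped RealInnerProductSpace Topology

section CentralLimit

variable {Ω Ω' E : Type*} [MeasurableSpace Ω] [MeasurableSpace Ω']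
  {P : Measure Ω} [IsProbabilityMeasure P] {P' : Measure Ω'} [IsProbabilityMeasure P']
  [NormedAddCommGroup E] [InnerProductSpace ℝ E] [MeasurableSpace E] [BorelSpace E]

lemma charFun_eq_charFun_map_inner_one (μ : Measure E) (t : E) :
    charFun μ t = charFun (μ.map fun x => ⟪x, t⟫) 1 := by
  rw [charFun_apply, charFun_apply_real, integral_map (by fun_prop) (by fun_prop)]
  simp

/-- **Central limit theorem** in a finite-dimensional real inner product space: normalized sums of
independent, identically distributed, centered, square integrable random vectors converge in
distribution to any random vector `G` that is centered Gaussian with the covariance of the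
summands. The last property is expressed by the characteristic function of `G`.

This is the Cramér–Wold reduction: by Lévy's theorem it suffices to treat the characteristic
functions, and their value at `t` is determined by the one-dimensional projections `⟪·, t⟫`. -/
theorem tendstoInDistribution_inv_sqrt_smul_sum [FiniteDimensional ℝ E]
    {Z : ℕ → Ω → E} {G : Ω' → E} (hG : AEMeasurable G P')
    (hG_charFun : ∀ t, charFun (P'.map G) t = Complex.exp (-Var[fun ω => ⟪Z 0 ω, t⟫; P] / 2))
    (hL2 : MemLp (Z 0) 2 P) (hmean : ∀ t, P[fun ω => ⟪Z 0 ω, t⟫] = 0)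
    (hindep : iIndepFun Z P) (hident : ∀ i, IdentDistrib (Z i) (Z 0) P P) :
    TendstoInDistribution (fun (n : ℕ) ω => (√n)⁻¹ • ∑ i ∈ Finset.range n, Z i ω) atTop G
      (fun _ => P) P' := by
  have hZ i : AEMeasurable (Z i) P := (hident i).aemeasurable_fst
  have hS (n : ℕ) : AEMeasurable (fun ω => (√n)⁻¹ • ∑ i ∈ Finset.range n, Z i ω) P := by
    fun_prop
  refine ⟨hS, hG, ProbabilityMeasure.tendsto_iff_tendsto_charFun.2 fun t => ?_⟩
  have hm : Measurable fun x : E => ⟪x, t⟫ := by fun_prop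
  have clt := tendstoInDistribution_inv_sqrt_mul_sum_sub (P := P)
    (X := fun i ω => ⟪Z i ω, t⟫) (Y := id)
    (P' := gaussianReal 0 Var[fun ω => ⟪Z 0 ω, t⟫; P].toNNReal) HasLaw.id
    (hL2.inner_const t) (hindep.comp (fun _ x => ⟪x, t⟫) fun _ => hm)
    (fun i => (hident i).comp hm)
  -- the one-dimensional theorem for `⟪Z i, t⟫` is used at the single frequency `1`
  have h1 := ProbabilityMeasure.tendsto_iff_tendsto_charFun.1 clt.tendsto 1
  simp only [ProbabilityMeasure.coe_mk, Measure.map_id, charFun_gaussianReal, hmean] at h1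
  simp only [ProbabilityMeasure.coe_mk, hG_charFun]
  convert h1 using 2 with n
  · rw [charFun_eq_charFun_map_inner_one,
      AEMeasurable.map_map_of_aemeasurable hm.aemeasurable (hS n)]
    congr 2
    ext ω
    simp [real_inner_smul_left, sum_inner]
  · simp [Real.coe_toNNReal _ (variance_nonneg _ _), neg_div]

end CentralLimit

section Gaussian

variable {E : Type*} [NormedAddCommGroup E] [InnerProductSpace ℝ E] [FiniteDimensional ℝ E]
  [MeasurableSpace E] [BorelSpace E]

/-- The standard Gaussian measure of a subspace `F`, regarded as a measure on the whole space, is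
the centered Gaussian measure whose covariance is the orthogonal projection to `F`. -/
lemma charFun_map_subtype_stdGaussian (F : Submodule ℝ E) (t : E) :
    charFun ((stdGaussian F).map (↑)) t = Complex.exp (-‖F.starProjection t‖ ^ 2 / 2) := by
  have h : charFun ((stdGaussian F).map (↑)) t
      = charFun (stdGaussian F) (F.orthogonalProjectionOnto t) := by
    rw [charFun_apply, charFun_apply, integral_map (by fun_prop) (by fun_prop)]
    simp
  rw [h, charFun_stdGaussian]
  simp

lemma map_norm_sq_stdGaussian {d : ℕ} (b : OrthonormalBasis (Fin d) ℝ E) :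
    (stdGaussian E).map (fun x => ‖x‖ ^ 2) = chiSquare d := by
  rw [stdGaussian_eq_map_pi_orthonormalBasis b, Measure.map_map (by fun_prop) (by fun_prop),
    chiSquare]
  congr 1
  ext z
  simp [← b.sum_sq_inner_right, b.orthonormal.inner_right_fintype]

end Gaussian

section Multinomial

variable {k : ℕ} {p : Fin k → ℝ}

/-- Every real function is integrable, since `multinomialOne p` is finitely supported. -/
lemma integrable_multinomialOne {f : (Fin k → ℝ) → ℝ} : Integrable f (multinomialOne p) := by
  rw [multinomialOne, integrable_finsetSum_measure]
  exact fun j _ => (integrable_dirac (by simp)).smul_measure ENNReal.ofReal_ne_top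

lemma integral_multinomialOne (hp : ∀ j, 0 ≤ p j) (f : (Fin k → ℝ) → ℝ) :
    ∫ x, f x ∂multinomialOne p = ∑ j, p j * f (Pi.single j 1) := by
  rw [multinomialOne, integral_finsetSum_measure fun j _ =>
    (integrable_dirac (by simp)).smul_measure ENNReal.ofReal_ne_top]
  simp [integral_smul_measure, hp]

/-- The vector `(√(p j))_j` of square roots of the cell probabilities; the covariance of a
standardized trial is the orthogonal projection along this vector. -/
noncomputable def sqrtProb (p : Fin k → ℝ) : EuclideanSpace ℝ (Fin k) :=
  WithLp.toLp 2 fun j => √(p j)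

/-- The outcome `x` of a trial, centered and scaled by `1 / √(p j)` in each coordinate `j`, as a
vector with the Euclidean norm. The scaling is by the factor of the Pearson statistic, not by the
standard deviation `√(p j * (1 - p j))` of the coordinate. -/
noncomputable def standardize (p x : Fin k → ℝ) : EuclideanSpace ℝ (Fin k) :=
  WithLp.toLp 2 fun j => (x j - p j) / √(p j)

lemma measurable_standardize (p : Fin k → ℝ) : Measurable (standardize p) := by
  unfold standardize
  fun_prop

lemma norm_sqrtProb (hp : ∀ j, 0 ≤ p j) (hsum : ∑ j, p j = 1) : ‖sqrtProb p‖ = 1 := by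
  simp [EuclideanSpace.norm_eq, sqrtProb, Real.sq_sqrt, hp, hsum]

lemma inner_standardize_single (t : EuclideanSpace ℝ (Fin k)) (j : Fin k) :
    ⟪standardize p (Pi.single j 1), t⟫ = t j / √(p j) - ⟪sqrtProb p, t⟫ := by
  have h i : p i / √(p i) = √(p i) := Real.div_sqrt
  simp only [standardize, sqrtProb, PiLp.inner_apply, sub_div, h, inner_sub_left,
    Finset.sum_sub_distrib]
  simp [Pi.single_apply, div_eq_mul_inv]

lemma integral_inner_standardize (hp : ∀ j, 0 < p j) (hsum : ∑ j, p j = 1)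
    (t : EuclideanSpace ℝ (Fin k)) :
    ∫ x, ⟪standardize p x, t⟫ ∂multinomialOne p = 0 := by
  rw [integral_multinomialOne fun j => (hp j).le]
  simp only [inner_standardize_single, mul_sub, Finset.sum_sub_distrib, ← Finset.sum_mul, hsum]
  rw [one_mul, sub_eq_zero]
  simp only [PiLp.inner_apply, sqrtProb]
  refine Finset.sum_congr rfl fun j _ => ?_
  rw [mul_div_left_comm, Real.div_sqrt]
  simp [mul_comm]

/-- The covariance of a standardized trial is the orthogonal projection to the hyperplane
orthogonal to `sqrtProb p`. -/
lemma integral_inner_standardize_sq (hp : ∀ j, 0 < p j) (hsum : ∑ j, p j = 1)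
    (t : EuclideanSpace ℝ (Fin k)) :
    ∫ x, ⟪standardize p x, t⟫ ^ 2 ∂multinomialOne p
      = ‖(ℝ ∙ sqrtProb p)ᗮ.starProjection t‖ ^ 2 := by
  have hproj : (ℝ ∙ sqrtProb p)ᗮ.starProjection t = t - ⟪sqrtProb p, t⟫ • sqrtProb p := by
    rw [Submodule.starProjection_orthogonal_val, Submodule.starProjection_unit_singleton ℝ
      (norm_sqrtProb (fun j => (hp j).le) hsum)]
  rw [integral_multinomialOne fun j => (hp j).le, hproj, EuclideanSpace.real_norm_sq_eq]
  refine Finset.sum_congr rfl fun j _ => ?_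
  have hq : √(p j) ≠ 0 := (Real.sqrt_pos.2 (hp j)).ne'
  rw [inner_standardize_single]
  -- the weight `p j = √(p j) ^ 2` is absorbed into the square
  nth_rw 1 [← Real.sq_sqrt (hp j).le]
  rw [← mul_pow, mul_sub, mul_div_cancel₀ _ hq]
  simp [sqrtProb, mul_comm]

/-- This includes `n = 0`, where both sides are `0`: on the left by division by zero. -/
lemma pearsonStatistic_eq_norm_sq {Ω : Type*} (hp : ∀ j, 0 ≤ p j)
    (X : ℕ → Ω → Fin k → ℝ) (n : ℕ) (ω : Ω) :
    pearsonStatistic p X n ω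
      = ‖(√n)⁻¹ • ∑ i ∈ Finset.range n, standardize p (X i ω)‖ ^ 2 := by
  rw [EuclideanSpace.real_norm_sq_eq]
  refine Finset.sum_congr rfl fun j _ => ?_
  simp [standardize, categoryCount, ← Finset.sum_div, Finset.sum_sub_distrib, mul_pow, div_pow,
    Real.sq_sqrt, hp]
  ring

end Multinomial

theorem mainTheorem1 {Ω Ω' : Type*} [MeasurableSpace Ω] [MeasurableSpace Ω']
    (P : Measure Ω) [IsProbabilityMeasure P] (P' : Measure Ω') [IsProbabilityMeasure P']
    (k : ℕ) (p : Fin k → ℝ) (hp_pos : ∀ j, 0 < p j) (hp_sum : ∑ j, p j = 1)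
    (X : ℕ → Ω → Fin k → ℝ) (hX_indep : iIndepFun X P)
    (hX_law : ∀ i, HasLaw (X i) (multinomialOne p) P)
    (Y : Ω' → ℝ) (hY : HasLaw Y (chiSquare (k - 1)) P') :
    TendstoInDistribution (pearsonStatistic p X) atTop Y (fun _ => P) P' := by
  obtain _ | d := k
  -- the cell probabilities sum to `1`, so there is at least one cell
  · simp at hp_sum
  have hq := norm_sqrtProb (fun j => (hp_pos j).le) hp_sum
  have hq0 : sqrtProb p ≠ 0 := by
    rintro h
    simp [h] at hq
  have : Fact (Module.finrank ℝ (EuclideanSpace ℝ (Fin (d + 1))) = d + 1) := ⟨by simp⟩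
  have hg := measurable_standardize p
  have hident i : IdentDistrib (X i) (X 0) P P :=
    ⟨(hX_law i).aemeasurable, (hX_law 0).aemeasurable, by
      rw [(hX_law i).map_eq, (hX_law 0).map_eq]⟩
  have hlaw (f : (Fin (d + 1) → ℝ) → ℝ) (hf : Measurable f) :
      ∫ ω, f (X 0 ω) ∂P = ∫ x, f x ∂multinomialOne p :=
    (hX_law 0).integral_comp hf.aestronglyMeasurable
  have hmean t : ∫ ω, ⟪standardize p (X 0 ω), t⟫ ∂P = 0 := by
    rw [hlaw (fun x => ⟪standardize p x, t⟫) (by fun_prop),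
      integral_inner_standardize hp_pos hp_sum]
  have hX0 := (hX_law 0).aemeasurable
  have hvar t : Var[fun ω => ⟪standardize p (X 0 ω), t⟫; P]
      = ‖(ℝ ∙ sqrtProb p)ᗮ.starProjection t‖ ^ 2 := by
    rw [variance_of_integral_eq_zero (by fun_prop) (hmean t),
      hlaw (fun x => ⟪standardize p x, t⟫ ^ 2) (by fun_prop),
      integral_inner_standardize_sq hp_pos hp_sum]
  have hL2 : MemLp (fun ω => standardize p (X 0 ω)) 2 P := by
    refine (memLp_two_iff_integrable_sq_norm
      (hg.comp_aemeasurable hX0).aestronglyMeasurable).2 ?_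
    refine Integrable.comp_aemeasurable (g := fun x => ‖standardize p x‖ ^ 2) ?_ hX0
    rw [(hX_law 0).map_eq]
    exact integrable_multinomialOne
  have clt := tendstoInDistribution_inv_sqrt_smul_sum
    (G := ((↑) : (ℝ ∙ sqrtProb p)ᗮ → EuclideanSpace ℝ (Fin (d + 1))))
    (P' := stdGaussian (ℝ ∙ sqrtProb p)ᗮ) (Z := fun i ω => standardize p (X i ω)) (by fun_prop)
    (fun t => by rw [charFun_map_subtype_stdGaussian, hvar]; simp) hL2 hmean
    (hX_indep.comp (fun _ => standardize p) fun _ => hg) (fun i => (hident i).comp hg)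
  have hlim := clt.continuous_comp (g := fun x => ‖x‖ ^ 2) (by fun_prop)
  have hstat : pearsonStatistic p X = fun n : ℕ => (fun x => ‖x‖ ^ 2) ∘
      fun ω => (√n)⁻¹ • ∑ i ∈ Finset.range n, standardize p (X i ω) := by
    ext n ω
    exact pearsonStatistic_eq_norm_sq (fun j => (hp_pos j).le) X n ω
  have hmap : P'.map Y = (stdGaussian (ℝ ∙ sqrtProb p)ᗮ).map fun x => ‖x‖ ^ 2 := by
    rw [hY.map_eq, Nat.add_sub_cancel,
      ← map_norm_sq_stdGaussian (OrthonormalBasis.fromOrthogonalSpanSingleton d hq0)]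
  rw [hstat]
  refine ⟨hlim.forall_aemeasurable, hY.aemeasurable, ?_⟩
  convert hlim.tendsto using 2
  exact congrArg 𝓝 (Subtype.ext hmap)
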